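/- Let $X\in\mathbb R^{n\times p}$ be a fixed matrix, $\beta^0\in\mathbb R^p$, and $Y=X\beta^0+\epsilon$, where $\epsilon\in\mathbb R^n$ has i.i.d. standard Gaussian entries. Let $0\le\lambda^*\le\lambda$, and let $$\hat\beta\in\arg\min_{b\in\mathbb R^p}\{\|Y-Xb\|_2^2+2\lambda\|b\|_1\},\qquad \beta^*\in\arg\min_{b\in\mathbb R^p}\{\|X(b-\beta^0)\|_2^2+2\lambda^*\|b\|_1\}.$$ Let $\zeta^*\in\mathbb R^p$ satisfy the KKT conditions $X^TX(\beta^*-\beta^0)+\lambda^*\zeta^*=0$, $\zeta^{*T}\beta^*=\|\beta^*\|_1$, $\|\zeta^*\|_\infty\le 1$. Fix a set $S\subset\{1,\dots,p\}$ of cardinality $s$ which contains the active set $S_*=\{j:\beta^*_j\ne0\}$ of $\beta^*$. For $j\notin S$ let $v_j^S$ be the Euclidean distance of the $j$-th column $X_j$ to the linear span of $\{X_k\}_{k\in S}$, i.e. $\{(v_j^S)^2\}_{j\notin S}$ are the diagonal elements of $A^TA$, where $A$ is the matrix of the residuals of the columns $\{X_j\}_{j\notin S}$ after orthogonal projection on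 that span. Assume that for some $t>0$ $$\lambda>\|v_{-S}^S\|_\infty\sqrt{2(\log(2p)+t)},$$ where $\|v_{-S}^S\|_\infty=\max_{j\notin S}v_j^S$ (and $0$ if there is no such $j$), and write $\bar v_j^S:=v_j^S\sqrt{2(\log(2p)+t)}/\lambda$, $j\notin S$. Suppose that $$\lambda^*|\zeta_j^*|/\lambda<1-\bar v_j^S\quad\forall\, j\notin S,$$ and define $$\bar w_j^S:=\frac{1-\bar v_j^S-\lambda^*|\zeta_j^*|/\lambda}{1-\lambda^*/\lambda},\quad j\notin S.$$ For non-negative weights $w=(w_j)_{j\notin S}$ let $$\hat\kappa^2(w,S):=\min\Big\{\,s\,\|Xb\|_2^2/n:\ b\in\mathbb R^p,\ \sum_{j\in S}|b_j|-\sum_{j\notin S}w_j|b_j|=1\Big\}$$ (with $\min\emptyset=\infty$, which is the case $S=\emptyset$). Then for all $x\ge0$, with probability at least $1-e^{-t}-e^{-x}$, $$\|X(\hat\beta-\beta^*)\|_2\le\sqrt{\frac{s}{\hat\kappa^2(\bar w^S,S)}}\,\sqrt{\frac{(\lambda-\lambda^*)^2}{n}}+\sqrt s+\sqrt{2x}.$$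 Here, if $\lambda^*<\lambda$, the first term on the right is $0$ if $s=0$, and $\infty$ if $s>0$ and $\hat\kappa^2(\bar w^S,S)=0$; if $\lambda^*=\lambda$ (when the weights $\bar w_j^S$ are formally infinite) it is read as $0$. -/

import Mathlib

open MeasureTheory ProbabilityTheory Matrix
open scoped ENNReal

noncomputable section

namespace Lasso

/-- The Euclidean norm of a vector of `ℝⁿ` (the norm of `Fin n → ℝ` itself is the sup norm). -/
def l2norm {n : ℕ} (v : Fin n → ℝ) : ℝ := ‖WithLp.toLp 2 v‖

/-- The `ℓ₁`-norm. -/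
def l1norm {p : ℕ} (b : Fin p → ℝ) : ℝ := ∑ j, |b j|

/-- `b` minimizes `‖Y - X b‖₂² + 2 λ ‖b‖₁` over `ℝᵖ`. -/
def IsLasso {n p : ℕ} (X : Matrix (Fin n) (Fin p) ℝ) (Y : Fin n → ℝ) (lam : ℝ)
    (b : Fin p → ℝ) : Prop :=
  IsMinOn (fun b : Fin p → ℝ => l2norm (Y - X *ᵥ b) ^ 2 + 2 * lam * l1norm b) Set.univ b

/-- `b` minimizes `‖X (b - β⁰)‖₂² + 2 λ* ‖b‖₁` over `ℝᵖ`. -/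
def IsNoiselessLasso {n p : ℕ} (X : Matrix (Fin n) (Fin p) ℝ) (beta0 : Fin p → ℝ)
    (lamStar : ℝ) (b : Fin p → ℝ) : Prop :=
  IsMinOn (fun b : Fin p → ℝ => l2norm (X *ᵥ (b - beta0)) ^ 2 + 2 * lamStar * l1norm b)
    Set.univ b

/-- The sub-differential of the `ℓ₁`-norm at `b`: all `z` with `zᵀ b = ‖b‖₁`, `‖z‖_∞ ≤ 1`. -/
def subdiffL1 {p : ℕ} (b : Fin p → ℝ) : Set (Fin p → ℝ) :=
  {z | z ⬝ᵥ b = l1norm b ∧ ‖z‖ ≤ 1}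

/-- The KKT conditions of the noiseless Lasso:
`Xᵀ X (β* - β⁰) + λ* ζ* = 0` with `ζ* ∈ ∂‖β*‖₁`. -/
def NoiselessKKT {n p : ℕ} (X : Matrix (Fin n) (Fin p) ℝ) (beta0 : Fin p → ℝ)
    (lamStar : ℝ) (betaStar zetaStar : Fin p → ℝ) : Prop :=
  zetaStar ∈ subdiffL1 betaStar ∧
    Xᵀ *ᵥ (X *ᵥ (betaStar - beta0)) + lamStar • zetaStar = 0

/-- The active set `{j : b_j ≠ 0}`. -/
def activeSet {p : ℕ} (b : Fin p → ℝ) : Finset (Fin p) := {j | b j ≠ 0}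

/-- The space spanned by the columns of `X` with index in `S`. -/
def colSpan {n p : ℕ} (X : Matrix (Fin n) (Fin p) ℝ) (S : Finset (Fin p)) :
    Submodule ℝ (EuclideanSpace ℝ (Fin n)) :=
  Submodule.span ℝ ((fun j => WithLp.toLp 2 (fun i => X i j)) '' (S : Set (Fin p)))

/-- The projection of `X_{-S}` on the column span of `X_S`, column by column. -/
def proj {n p : ℕ} (X : Matrix (Fin n) (Fin p) ℝ) (S : Finset (Fin p)) :
    Matrix (Fin n) {j : Fin p // j ∉ S} ℝ :=
  Matrix.of fun i j => (colSpan X S).starProjection (WithLp.toLp 2 (fun i => X i j)) i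

/-- The anti-projection `X_{-S} - (projection of X_{-S})`. -/
def antiProj {n p : ℕ} (X : Matrix (Fin n) (Fin p) ℝ) (S : Finset (Fin p)) :
    Matrix (Fin n) {j : Fin p // j ∉ S} ℝ :=
  Matrix.of fun i j => X i j - proj X S i j

/-- The Gram matrix of the anti-projection. -/
def VMat {n p : ℕ} (X : Matrix (Fin n) (Fin p) ℝ) (S : Finset (Fin p)) :
    Matrix {j : Fin p // j ∉ S} {j : Fin p // j ∉ S} ℝ :=
  (antiProj X S)ᵀ * antiProj X S

/-- The vector `v^S_{-S}` of the square roots of the diagonal elements of `VMat X S`. -/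
def v {n p : ℕ} (X : Matrix (Fin n) (Fin p) ℝ) (S : Finset (Fin p)) :
    {j : Fin p // j ∉ S} → ℝ :=
  fun j => √(VMat X S j j)

/-- `v̄_j^S = v_j^S √(2 (log (2p) + t)) / λ`. -/
def vbar {n p : ℕ} (X : Matrix (Fin n) (Fin p) ℝ) (S : Finset (Fin p)) (lam t : ℝ) :
    {j : Fin p // j ∉ S} → ℝ :=
  fun j => v X S j * √(2 * (Real.log (2 * p) + t)) / lam

/-- `w̄_j^S = (1 - v̄_j^S - λ* |ζ*_j| / λ) / (1 - λ* / λ)`. -/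
def wbar {n p : ℕ} (X : Matrix (Fin n) (Fin p) ℝ) (S : Finset (Fin p)) (lam lamStar t : ℝ)
    (zetaStar : Fin p → ℝ) : {j : Fin p // j ∉ S} → ℝ :=
  fun j => (1 - vbar X S lam t j - lamStar * |zetaStar j| / lam) / (1 - lamStar / lam)

/-- The (squared) empirical compatibility constant: the minimum of `|S| ‖X b‖₂² / n` over all
`b` with `‖b_S‖₁ - ‖W b_{-S}‖₁ = 1`. It takes values in `[0, ∞]`; it is `∞` for `S = ∅`, where
(for non-negative weights) no `b` is admissible. -/
def kappaSq {n p : ℕ} (X : Matrix (Fin n) (Fin p) ℝ) (S : Finset (Fin p))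
    (w : {j : Fin p // j ∉ S} → ℝ) : ℝ≥0∞ :=
  ⨅ b ∈ {b : Fin p → ℝ | ∑ j ∈ S, |b j| - ∑ j : {j : Fin p // j ∉ S}, |w j * b j| = 1},
    ENNReal.ofReal (S.card * l2norm (X *ᵥ b) ^ 2 / n)

end Lasso

end

/-!
Write `d = β̂ - β*` and let `U` be the span of the columns of `X` with index in `S`. Minimality of
`β̂`, tested along the segment from `β̂` to `β*`, together with the KKT conditions of `β*`, gives
`‖X d‖² ≤ ⟪ε, X d⟫ + λ (‖β*‖₁ - ‖β̂‖₁) + λ* ⟪ζ*, d⟫`.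

The noise term is split along `U` and `Uᗮ`. The part in `U` is at most `‖Π_U ε‖ ‖X d‖`. The part in
`Uᗮ` only involves the residuals of the columns outside `S`, and is at most
`λ ∑_{j ∉ S} v̄_j |d_j|` as soon as `|⟪residual_j, ε⟫| ≤ ‖residual_j‖ √(2 (log (2p) + t))` for all
`j`. Coordinatewise, the penalty terms are at most `(λ - λ*) |d_j|` for `j ∈ S` and
`-(λ - λ* |ζ*_j|) |d_j|` for `j ∉ S`. Hence (`Lasso.l2norm_sq_sub_le_of_isLasso`)
`‖X d‖² ≤ ‖Π_U ε‖ ‖X d‖ + (λ - λ*) (∑_{j ∈ S} |d_j| - ∑_{j ∉ S} w̄_j |d_j|)`,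
and the last bracket, when positive, is at most `√(s / κ̂²) ‖X d‖ / √n` by the definition of `κ̂²`
(`Lasso.ofReal_l2norm_le`). If `λ = λ*`, the weights `w̄_j` are not defined, but the coefficients
`(λ - λ*) w̄_j = λ - λ v̄_j - λ* |ζ*_j|` still are, and by their positivity the remainder is at most
`0`.

Two Gaussian tail bounds control the noise. The law of `ε` is the standard Gaussian of `ℝⁿ`, and its
orthogonal projection to `U` is the standard Gaussian of `U`, whose norm exceeds
`√(dim U) + √(2x)` with probability at most `e⁻ˣ`
(`stdGaussian_norm_starProjection_gt_le`). A union bound over the columns handles the residuals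
(`Lasso.stdGaussian_exists_residual_gt_le`). As `β̂` need not be measurable, the two bounds are
combined through the outer measure of the complement of the event.
-/

/-! ### Tail bounds for the standard Gaussian distribution -/

/-- The moment generating function of the square of a standard Gaussian variable at `u < 1 / 2`,
parametrized by its value `c = (1 - 2 u)^(-1/2)`. -/
theorem integral_exp_mul_sq_gaussianReal {c : ℝ} (hc : 0 < c) :
    ∫ x, Real.exp ((1 - (c ^ 2)⁻¹) / 2 * x ^ 2) ∂(gaussianReal 0 1) = c := by
  rw [integral_gaussianReal_eq_integral_smul one_ne_zero]
  have h : ∀ x : ℝ, gaussianPDFReal 0 1 x • Real.exp ((1 - (c ^ 2)⁻¹) / 2 * x ^ 2)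
      = (√(2 * Real.pi))⁻¹ * Real.exp (-((c ^ 2)⁻¹ / 2) * x ^ 2) := by
    intro x
    rw [gaussianPDFReal_def, smul_eq_mul, mul_assoc, ← Real.exp_add]
    simp only [NNReal.coe_one, mul_one, sub_zero]
    congr 2
    ring
  simp_rw [h]
  rw [integral_const_mul, integral_gaussian,
    show Real.pi / ((c ^ 2)⁻¹ / 2) = (2 * Real.pi) * c ^ 2 by field_simp,
    Real.sqrt_mul (x := 2 * Real.pi) (by positivity), Real.sqrt_sq hc.le]
  field_simp

theorem integrable_exp_mul_sq_gaussianReal {c : ℝ} (hc : 0 < c) :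
    Integrable (fun x : ℝ => Real.exp ((1 - (c ^ 2)⁻¹) / 2 * x ^ 2)) (gaussianReal 0 1) := by
  -- The integral is `c ≠ 0`, whereas the Bochner integral of a non-integrable function is `0`.
  by_contra h
  have := integral_exp_mul_sq_gaussianReal hc
  rw [integral_undef h] at this
  exact hc.ne this

/-- An upper tail bound for the chi-square distribution with `r` degrees of freedom. -/
theorem measure_pi_gaussianReal_sum_sq_gt_le (r : ℕ) {x : ℝ} (hx : 0 ≤ x) :
    Measure.pi (fun _ : Fin r => gaussianReal 0 1)
      {y | (√r + √(2 * x)) ^ 2 < ∑ i, y i ^ 2} ≤ ENNReal.ofReal (Real.exp (-x)) := by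
  rcases Nat.eq_zero_or_pos r with rfl | hr
  · have : {y : Fin 0 → ℝ | (√(0 : ℕ) + √(2 * x)) ^ 2 < ∑ i, y i ^ 2} = ∅ := by
      ext y
      simp only [Finset.univ_eq_empty, Finset.sum_empty, Set.mem_ofPred_eq, Set.mem_empty_iff_false,
        iff_false, not_lt]
      positivity
    rw [this]
    simp
  have hq : 0 < √(r : ℝ) := Real.sqrt_pos.2 (by exact_mod_cast hr)
  have hq2 : √(r : ℝ) ^ 2 = r := Real.sq_sqrt (Nat.cast_nonneg r)
  have hz2 : √(2 * x) ^ 2 = 2 * x := Real.sq_sqrt (by positivity)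
  have hz : 0 ≤ √(2 * x) := Real.sqrt_nonneg _
  set q := √(r : ℝ)
  set z := √(2 * x)
  -- Chernoff's bound at its optimal exponent `u`, where `1 - 2 u = r / (q + z)² = c⁻²`.
  set c : ℝ := 1 + z / q with hcdef
  have hc1 : 1 ≤ c := by
    have : 0 ≤ z / q := by positivity
    linarith
  have hc : 0 < c := by linarith
  set u : ℝ := (1 - (c ^ 2)⁻¹) / 2 with hu
  have hu0 : 0 ≤ u := by
    have : (c ^ 2)⁻¹ ≤ 1 := inv_le_one_of_one_le₀ (one_le_pow₀ hc1)
    rw [hu]; linarith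
  set μ : Measure (Fin r → ℝ) := Measure.pi (fun _ : Fin r => gaussianReal 0 1)
  have hexp : ∀ y : Fin r → ℝ, Real.exp (u * ∑ i, y i ^ 2) = ∏ i, Real.exp (u * y i ^ 2) := by
    intro y
    rw [Finset.mul_sum, Real.exp_sum]
  have hmgf : mgf (fun y : Fin r → ℝ => ∑ i, y i ^ 2) μ u = c ^ r := by
    rw [mgf]
    simp_rw [hexp]
    rw [integral_fintype_prod_eq_prod (f := fun _ (x : ℝ) => Real.exp (u * x ^ 2))]
    rw [integral_exp_mul_sq_gaussianReal hc]
    simp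
  have hint : Integrable (fun y : Fin r → ℝ => Real.exp (u * ∑ i, y i ^ 2)) μ := by
    simp_rw [hexp]
    exact Integrable.fintype_prod fun _ => integrable_exp_mul_sq_gaussianReal hc
  have hbound := measure_ge_le_exp_mul_mgf ((q + z) ^ 2) hu0 hint
  rw [hmgf] at hbound
  have hcr : c ^ r ≤ Real.exp (q * z) := by
    calc c ^ r ≤ Real.exp (z / q) ^ r := by
          gcongr
          rw [hcdef, add_comm]
          exact Real.add_one_le_exp _
      _ = Real.exp (q * z) := by
          rw [← Real.exp_nat_mul, ← hq2]
          congr 1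
          field_simp
  -- Here `u (q + z)² = q z + z² / 2` and `z² / 2 = x`, so that the factor
  -- `exp (q z)` bounding `c ^ r` cancels.
  have hua : -u * (q + z) ^ 2 = -(q * z) - x := by
    have hcq : c = (q + z) / q := by rw [hcdef]; field_simp
    have : q + z ≠ 0 := by positivity
    rw [hu, hcq]
    field_simp
    linear_combination -hz2
  have hfin : μ.real {y | (q + z) ^ 2 ≤ ∑ i, y i ^ 2} ≤ Real.exp (-x) := by
    refine hbound.trans ?_
    rw [hua]
    calc _ ≤ Real.exp (-(q * z) - x) * Real.exp (q * z) := by gcongr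
      _ = Real.exp (-x) := by rw [← Real.exp_add]; congr 1; ring
  calc μ {y | (q + z) ^ 2 < ∑ i, y i ^ 2} ≤ μ {y | (q + z) ^ 2 ≤ ∑ i, y i ^ 2} :=
        measure_mono (Set.ofPred_subset_ofPred.2 fun y hy => le_of_lt hy)
    _ ≤ _ := by
        rw [← ofReal_measureReal]
        exact ENNReal.ofReal_le_ofReal hfin

theorem stdGaussian_norm_gt_le {E : Type*} [NormedAddCommGroup E] [InnerProductSpace ℝ E]
    [FiniteDimensional ℝ E] [MeasurableSpace E] [BorelSpace E] {x : ℝ} (hx : 0 ≤ x) :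
    stdGaussian E {u | √(Module.finrank ℝ E) + √(2 * x) < ‖u‖}
      ≤ ENNReal.ofReal (Real.exp (-x)) := by
  rw [stdGaussian, Measure.map_apply (by fun_prop)
    (measurableSet_lt measurable_const measurable_norm)]
  refine le_trans (measure_mono fun y hy => ?_) (measure_pi_gaussianReal_sum_sq_gt_le _ hx)
  simp only [Set.mem_preimage, Set.mem_ofPred_eq] at hy ⊢
  have : ‖∑ i, y i • stdOrthonormalBasis ℝ E i‖ ^ 2 = ∑ i, y i ^ 2 := by
    rw [← (stdOrthonormalBasis ℝ E).sum_sq_inner_right]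
    refine Finset.sum_congr rfl fun i _ => ?_
    rw [(stdOrthonormalBasis ℝ E).orthonormal.inner_right_fintype]
  rw [← this]
  gcongr

theorem stdGaussian_map_orthogonalProjectionOnto {E : Type*} [NormedAddCommGroup E]
    [InnerProductSpace ℝ E] [FiniteDimensional ℝ E] [MeasurableSpace E] [BorelSpace E]
    (U : Submodule ℝ E) :
    (stdGaussian E).map U.orthogonalProjectionOnto = stdGaussian U := by
  have : IsProbabilityMeasure ((stdGaussian E).map U.orthogonalProjectionOnto) :=
    Measure.isProbabilityMeasure_map (by fun_prop)
  apply Measure.ext_of_charFun (E := U)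
  ext u
  rw [charFun_stdGaussian, charFun_apply, integral_map (by fun_prop) (by fun_prop)]
  have h : ∀ x : E, inner ℝ (U.orthogonalProjectionOnto x) u = inner ℝ x (u : E) := fun x => by
    simp
  simp_rw [h]
  rw [← charFun_apply, charFun_stdGaussian]
  simp

/-- The projection to `U` is standard Gaussian in dimension `finrank U`, so its norm concentrates at
the square root of that dimension, however large the ambient space is. -/
theorem stdGaussian_norm_starProjection_gt_le {E : Type*} [NormedAddCommGroup E]
    [InnerProductSpace ℝ E] [FiniteDimensional ℝ E] [MeasurableSpace E] [BorelSpace E]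
    (U : Submodule ℝ E) {s : ℕ} (hs : Module.finrank ℝ U ≤ s) {x : ℝ} (hx : 0 ≤ x) :
    stdGaussian E {e | √s + √(2 * x) < ‖U.starProjection e‖} ≤ ENNReal.ofReal (Real.exp (-x)) := by
  have h := stdGaussian_norm_gt_le (E := U) hx
  rw [← stdGaussian_map_orthogonalProjectionOnto, Measure.map_apply (by fun_prop)
    (measurableSet_lt measurable_const measurable_norm)] at h
  refine le_trans (measure_mono fun e he => ?_) h
  simp only [Set.mem_preimage, Set.mem_ofPred_eq] at he ⊢
  have : √(Module.finrank ℝ U : ℝ) ≤ √(s : ℝ) := Real.sqrt_le_sqrt (by exact_mod_cast hs)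
  calc _ ≤ √s + √(2 * x) := by gcongr
    _ < _ := he

theorem stdGaussian_inner_gt_le {E : Type*} [NormedAddCommGroup E] [InnerProductSpace ℝ E]
    [FiniteDimensional ℝ E] [MeasurableSpace E] [BorelSpace E] (a : E) {τ : ℝ} (hτ : 0 ≤ τ) :
    stdGaussian E {e | ‖a‖ * τ < inner ℝ a e} ≤ ENNReal.ofReal (Real.exp (-(τ ^ 2 / 2))) := by
  rcases eq_or_ne a 0 with rfl | ha
  · simp
  have ha' : 0 < ‖a‖ := norm_pos_iff.2 ha
  have hlaw : (stdGaussian E).map (innerSL ℝ a) = gaussianReal 0 (‖a‖ ^ 2).toNNReal := by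
    rw [IsGaussian.map_eq_gaussianReal, integral_strongDual_stdGaussian,
      variance_dual_stdGaussian, innerSL_apply_norm]
  have hint : Integrable (fun e => Real.exp (τ / ‖a‖ * innerSL ℝ a e)) (stdGaussian E) := by
    have h := integrable_exp_mul_gaussianReal (μ := 0) (v := (‖a‖ ^ 2).toNNReal) (τ / ‖a‖)
    rw [← hlaw, integrable_map_measure (by fun_prop) (by fun_prop)] at h
    exact h
  have h := measure_ge_le_exp_mul_mgf (‖a‖ * τ) (by positivity) hint
  rw [mgf_gaussianReal hlaw, ← Real.exp_add, Real.coe_toNNReal _ (by positivity)] at h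
  have he : -(τ / ‖a‖) * (‖a‖ * τ) + (0 * (τ / ‖a‖) + ‖a‖ ^ 2 * (τ / ‖a‖) ^ 2 / 2)
      = -(τ ^ 2 / 2) := by
    field_simp
    ring
  rw [he] at h
  refine le_trans (measure_mono (t := {e | ‖a‖ * τ ≤ innerSL ℝ a e})
    (Set.ofPred_subset_ofPred.2 fun e he => le_of_lt he)) ?_
  rw [← ofReal_measureReal]
  exact ENNReal.ofReal_le_ofReal h

theorem stdGaussian_abs_inner_gt_le {E : Type*} [NormedAddCommGroup E] [InnerProductSpace ℝ E]
    [FiniteDimensional ℝ E] [MeasurableSpace E] [BorelSpace E] (a : E) {τ : ℝ} (hτ : 0 ≤ τ) :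
    stdGaussian E {e | ‖a‖ * τ < |inner ℝ a e|}
      ≤ 2 * ENNReal.ofReal (Real.exp (-(τ ^ 2 / 2))) := by
  have hsub : {e : E | ‖a‖ * τ < |inner ℝ a e|}
      ⊆ {e | ‖a‖ * τ < inner ℝ a e} ∪ {e | ‖-a‖ * τ < inner ℝ (-a) e} := by
    intro e he
    simpa [lt_abs, inner_neg_left] using he
  rw [two_mul]
  exact (measure_mono hsub).trans ((measure_union_le _ _).trans
    (add_le_add (stdGaussian_inner_gt_le a hτ) (stdGaussian_inner_gt_le (-a) hτ)))

theorem hasLaw_toLp_stdGaussian {Ω : Type*} [MeasurableSpace Ω] {P : Measure Ω}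
    [IsProbabilityMeasure P] {n : ℕ} {ε : Ω → Fin n → ℝ}
    (hlaw : ∀ i, HasLaw (fun ω => ε ω i) (gaussianReal 0 1) P)
    (hindep : iIndepFun (fun i ω => ε ω i) P) :
    HasLaw (fun ω => WithLp.toLp 2 (ε ω)) (stdGaussian (EuclideanSpace ℝ (Fin n))) P := by
  have hm : AEMeasurable ε P := aemeasurable_pi_iff.2 fun i => (hlaw i).aemeasurable
  refine ⟨by fun_prop, ?_⟩
  have h := (iIndepFun_iff_map_fun_eq_pi_map fun i => (hlaw i).aemeasurable).1 hindep
  simp_rw [fun i => (hlaw i).map_eq] at h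
  rw [← map_pi_eq_stdGaussian, ← h, AEMeasurable.map_map_of_aemeasurable (by fun_prop) hm]
  rfl

/-! ### The Lasso estimator: the deterministic inequality -/

namespace Lasso

variable {n p : ℕ}

theorem inner_toLp_eq_dotProduct (a b : Fin n → ℝ) :
    inner ℝ (WithLp.toLp 2 a) (WithLp.toLp 2 b) = a ⬝ᵥ b := by
  rw [EuclideanSpace.inner_toLp_toLp, dotProduct_comm]
  simp

theorem l2norm_sq (a : Fin n → ℝ) : l2norm a ^ 2 = a ⬝ᵥ a := by
  rw [← inner_toLp_eq_dotProduct, real_inner_self_eq_norm_sq, l2norm]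

/-- Convexity of the `ℓ₁`-norm along the segment from `b` to `c`. -/
theorem l1norm_combo_le (b c : Fin p → ℝ) {τ : ℝ} (h0 : 0 ≤ τ) (h1 : τ ≤ 1) :
    l1norm (b - τ • (b - c)) ≤ (1 - τ) * l1norm b + τ * l1norm c := by
  simp only [l1norm, Finset.mul_sum, ← Finset.sum_add_distrib]
  refine Finset.sum_le_sum fun j _ => ?_
  have : (b - τ • (b - c)) j = (1 - τ) * b j + τ * c j := by
    simp only [Pi.sub_apply, Pi.smul_apply, smul_eq_mul]
    ring
  rw [this]
  refine (abs_add_le _ _).trans ?_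
  rw [abs_mul, abs_mul, abs_of_nonneg h0, abs_of_nonneg (sub_nonneg.2 h1)]

/-- First-order optimality of the Lasso in the direction of `c`: the derivative of the convex
objective along the segment from `b` to `c` is non-negative at `b`. -/
theorem IsLasso.dotProduct_le {X : Matrix (Fin n) (Fin p) ℝ} {Y : Fin n → ℝ} {lam : ℝ}
    {b : Fin p → ℝ} (h : IsLasso X Y lam b) (hlam : 0 ≤ lam) (c : Fin p → ℝ) :
    (X *ᵥ b - Y) ⬝ᵥ (X *ᵥ (b - c)) ≤ lam * (l1norm c - l1norm b) := by
  set D := X *ᵥ (b - c) with hD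
  -- Minimality against the point at parameter `τ` of the segment, divided by `2 τ`.
  have key : ∀ τ : ℝ, 0 < τ → τ ≤ 1 →
      (X *ᵥ b - Y) ⬝ᵥ D - lam * (l1norm c - l1norm b) ≤ τ * (D ⬝ᵥ D / 2) := by
    intro τ h0 h1
    have hmin := isMinOn_iff.1 h (b - τ • (b - c)) (Set.mem_univ _)
    have hres : Y - X *ᵥ (b - τ • (b - c)) = (Y - X *ᵥ b) + τ • D := by
      rw [mulVec_sub, mulVec_smul, ← hD]
      abel
    have hneg : (X *ᵥ b - Y) ⬝ᵥ D = -((Y - X *ᵥ b) ⬝ᵥ D) := by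
      rw [← neg_dotProduct, neg_sub]
    have hl := mul_le_mul_of_nonneg_left (l1norm_combo_le b c h0.le h1) hlam
    simp only [hres, l2norm_sq, add_dotProduct, dotProduct_add, smul_dotProduct, dotProduct_smul,
      smul_eq_mul, dotProduct_comm D] at hmin
    rw [hneg]
    refine le_of_mul_le_mul_left ?_ h0
    linarith
  -- Let `τ → 0`: a positive gap `g` is already contradicted at `τ = g / (D ⬝ᵥ D + g)`.
  by_contra! hcon
  set g := (X *ᵥ b - Y) ⬝ᵥ D - lam * (l1norm c - l1norm b) with hg
  have hgpos : 0 < g := by rw [hg]; linarith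
  have hDD : 0 ≤ D ⬝ᵥ D := by rw [← l2norm_sq]; positivity
  have := key (g / (D ⬝ᵥ D + g)) (by positivity) (div_le_one_of_le₀ (by linarith) (by linarith))
  rw [div_mul_eq_mul_div, le_div_iff₀ (by linarith)] at this
  nlinarith

/-- The `j`-th column of `X` as a vector of Euclidean space. -/
noncomputable def column (X : Matrix (Fin n) (Fin p) ℝ) (j : Fin p) : EuclideanSpace ℝ (Fin n) :=
  WithLp.toLp 2 (fun i => X i j)

/-- The residual of the `j`-th column of `X` after orthogonal projection on the span of the columns
in `S`. It is defined for all `j`, and vanishes for `j ∈ S`. -/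
noncomputable def residual (X : Matrix (Fin n) (Fin p) ℝ) (S : Finset (Fin p)) (j : Fin p) :
    EuclideanSpace ℝ (Fin n) :=
  column X j - (colSpan X S).starProjection (column X j)

theorem residual_eq_zero {X : Matrix (Fin n) (Fin p) ℝ} {S : Finset (Fin p)} {j : Fin p}
    (hj : j ∈ S) : residual X S j = 0 := by
  rw [residual, sub_eq_zero, eq_comm, Submodule.starProjection_eq_self_iff]
  exact Submodule.subset_span ⟨j, hj, rfl⟩

theorem v_eq_norm_residual (X : Matrix (Fin n) (Fin p) ℝ) (S : Finset (Fin p))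
    (j : {j : Fin p // j ∉ S}) : v X S j = ‖residual X S j‖ := by
  rw [v, EuclideanSpace.norm_eq, VMat, mul_apply]
  congr 1
  refine Finset.sum_congr rfl fun i _ => ?_
  rw [Real.norm_eq_abs, sq_abs, sq]
  rfl

theorem finrank_colSpan_le (X : Matrix (Fin n) (Fin p) ℝ) (S : Finset (Fin p)) :
    Module.finrank ℝ (colSpan X S) ≤ S.card := by
  classical
  rw [colSpan, ← Finset.coe_image]
  exact (finrank_span_finset_le_card _).trans Finset.card_image_le

theorem toLp_mulVec (X : Matrix (Fin n) (Fin p) ℝ) (d : Fin p → ℝ) :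
    WithLp.toLp 2 (X *ᵥ d) = ∑ j, d j • column X j := by
  ext i
  simp [mulVec, dotProduct, column, mul_comm]

/-- The noise term, split into its components along the span of the columns in `S` and along the
residuals of the other columns. -/
theorem dotProduct_mulVec_le {X : Matrix (Fin n) (Fin p) ℝ} {S : Finset (Fin p)} {τ : ℝ}
    {e : Fin n → ℝ}
    (he : ∀ j : {j : Fin p // j ∉ S},
      |inner ℝ (residual X S j) (WithLp.toLp 2 e)| ≤ ‖residual X S j‖ * τ)
    (d : Fin p → ℝ) :
    e ⬝ᵥ (X *ᵥ d) ≤ ‖(colSpan X S).starProjection (WithLp.toLp 2 e)‖ * l2norm (X *ᵥ d)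
      + ∑ j : {j : Fin p // j ∉ S}, v X S j * τ * |d j| := by
  set U := colSpan X S
  set E := WithLp.toLp 2 e
  have hsplit : WithLp.toLp 2 (X *ᵥ d) = U.starProjection (WithLp.toLp 2 (X *ᵥ d))
      + ∑ j, d j • residual X S j := by
    simp_rw [residual, smul_sub, Finset.sum_sub_distrib, toLp_mulVec, map_sum, map_smul]
    abel
  have h1 : inner ℝ E (U.starProjection (WithLp.toLp 2 (X *ᵥ d)))
      ≤ ‖U.starProjection E‖ * l2norm (X *ᵥ d) := by
    rw [← U.inner_starProjection_left_eq_right]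
    exact real_inner_le_norm _ _
  have h2 : inner ℝ E (∑ j, d j • residual X S j)
      ≤ ∑ j : {j : Fin p // j ∉ S}, v X S j * τ * |d j| := by
    have hsum : ∑ j, d j • residual X S j
        = ∑ j : {j : Fin p // j ∉ S}, d j • residual X S j := by
      rw [← Fintype.sum_subtype_add_sum_subtype (fun j => j ∈ S)]
      rw [Finset.sum_eq_zero (fun j _ => by rw [residual_eq_zero j.2, smul_zero]), zero_add]
    rw [hsum, inner_sum]
    refine Finset.sum_le_sum fun j _ => ?_
    rw [real_inner_smul_right, real_inner_comm, v_eq_norm_residual]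
    refine (le_abs_self _).trans ?_
    rw [abs_mul, mul_comm]
    exact mul_le_mul_of_nonneg_right (he j) (abs_nonneg _)
  rw [← inner_toLp_eq_dotProduct, hsplit, inner_add_right]
  exact add_le_add h1 h2

theorem mul_le_abs_of_norm_le_one {z : Fin p → ℝ} (hz : ‖z‖ ≤ 1) (b : Fin p → ℝ) (j : Fin p) :
    z j * b j ≤ |b j| := by
  have hj : |z j| ≤ 1 := (norm_le_pi_norm z j).trans hz
  calc z j * b j ≤ |z j| * |b j| := by rw [← abs_mul]; exact le_abs_self _
    _ ≤ 1 * |b j| := by gcongr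
    _ = |b j| := one_mul _

/-- The identity `zᵀ b = ‖b‖₁` holds coordinatewise, as each term of the left side is at most the
corresponding term of the right side. -/
theorem mul_eq_abs_of_mem_subdiffL1 {b z : Fin p → ℝ} (hz : z ∈ subdiffL1 b) (j : Fin p) :
    z j * b j = |b j| := by
  obtain ⟨h1, h2⟩ := hz
  exact (Finset.sum_eq_sum_iff_of_le fun i _ => mul_le_abs_of_norm_le_one h2 b i).1 h1 j
    (Finset.mem_univ j)

/-- The deterministic core: the inequality for the prediction error on the event that the noise is
nearly orthogonal to all residuals. -/
theorem l2norm_sq_sub_le_of_isLasso {X : Matrix (Fin n) (Fin p) ℝ} {beta0 : Fin p → ℝ}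
    {e : Fin n → ℝ} {lam lamStar τ : ℝ} (hlamStar : 0 ≤ lamStar) (hle : lamStar ≤ lam)
    {b betaStar zetaStar : Fin p → ℝ} (hb : IsLasso X (X *ᵥ beta0 + e) lam b)
    (hKKT : NoiselessKKT X beta0 lamStar betaStar zetaStar)
    {S : Finset (Fin p)} (hS : activeSet betaStar ⊆ S)
    (he : ∀ j : {j : Fin p // j ∉ S},
      |inner ℝ (residual X S j) (WithLp.toLp 2 e)| ≤ ‖residual X S j‖ * τ) :
    l2norm (X *ᵥ (b - betaStar)) ^ 2
      ≤ ‖(colSpan X S).starProjection (WithLp.toLp 2 e)‖ * l2norm (X *ᵥ (b - betaStar))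
        + ((lam - lamStar) * ∑ j ∈ S, |(b - betaStar) j|
          - ∑ j : {j : Fin p // j ∉ S},
              (lam - v X S j * τ - lamStar * |zetaStar j|) * |(b - betaStar) j|) := by
  set d := b - betaStar with hd
  have h1 := hb.dotProduct_le (hlamStar.trans hle) betaStar
  have h2 := dotProduct_mulVec_le he d
  have h3 : (X *ᵥ (betaStar - beta0)) ⬝ᵥ (X *ᵥ d) = -(lamStar * (zetaStar ⬝ᵥ d)) := by
    rw [dotProduct_mulVec, ← mulVec_transpose, eq_neg_of_add_eq_zero_left hKKT.2,
      neg_dotProduct, smul_dotProduct, smul_eq_mul]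
  have h4 : X *ᵥ b - (X *ᵥ beta0 + e) = X *ᵥ d + X *ᵥ (betaStar - beta0) - e := by
    rw [hd, mulVec_sub, mulVec_sub]
    abel
  rw [h4, sub_dotProduct, add_dotProduct, h3, ← l2norm_sq] at h1
  have h5 : lam * (l1norm betaStar - l1norm b) + lamStar * (zetaStar ⬝ᵥ d)
      ≤ (lam - lamStar) * ∑ j ∈ S, |d j|
        - ∑ j : {j : Fin p // j ∉ S}, (lam - lamStar * |zetaStar j|) * |d j| := by
    have hsum : lam * (l1norm betaStar - l1norm b) + lamStar * (zetaStar ⬝ᵥ d)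
        = ∑ j, (lam * (|betaStar j| - |b j|) + lamStar * (zetaStar j * d j)) := by
      simp only [l1norm, dotProduct, Finset.sum_add_distrib, ← Finset.mul_sum,
        Finset.sum_sub_distrib]
    rw [hsum, ← Fintype.sum_subtype_add_sum_subtype (fun j => j ∈ S), Finset.mul_sum,
      Finset.sum_subtype S (p := (· ∈ S)) (fun _ => Iff.rfl), sub_eq_add_neg,
      ← Finset.sum_neg_distrib]
    refine add_le_add (Finset.sum_le_sum fun j _ => ?_) (Finset.sum_le_sum fun j _ => ?_)
    -- For `j ∈ S`, write the term as
    -- `λ* (ζ*_j b_j - |b_j|) + (λ - λ*) (|β*_j| - |b_j|)` using `ζ*_j β*_j = |β*_j|`.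
    · have hz := mul_le_abs_of_norm_le_one hKKT.1.2 b j
      have hd' : |betaStar j| - |b j| ≤ |d j| := by
        rw [hd, Pi.sub_apply, abs_sub_comm]
        exact abs_sub_abs_le_abs_sub _ _
      have e1 := mul_le_mul_of_nonneg_left hz hlamStar
      have e2 := mul_le_mul_of_nonneg_left hd' (sub_nonneg.2 hle)
      have e3 := mul_eq_abs_of_mem_subdiffL1 hKKT.1 j
      have e4 : zetaStar j * d j = zetaStar j * b j - |betaStar j| := by
        rw [← e3, hd, Pi.sub_apply]; ring
      rw [e4]
      linarith
    -- For `j ∉ S`, `β*_j = 0`, so that `d_j = b_j`.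
    · have h0 : betaStar j = 0 := by
        by_contra hne
        exact j.2 (hS (by simp [activeSet, hne]))
      have hbd : b j = d j := by rw [hd, Pi.sub_apply, h0, sub_zero]
      have e1 : zetaStar j * d j ≤ |zetaStar j| * |d j| := by
        rw [← abs_mul]; exact le_abs_self _
      have e2 := mul_le_mul_of_nonneg_left e1 hlamStar
      rw [h0, hbd, abs_zero]
      linarith
  have h6 : ∑ j : {j : Fin p // j ∉ S}, (lam - v X S j * τ - lamStar * |zetaStar j|) * |d j|
      = ∑ j : {j : Fin p // j ∉ S}, (lam - lamStar * |zetaStar j|) * |d j|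
        - ∑ j : {j : Fin p // j ∉ S}, v X S j * τ * |d j| := by
    rw [← Finset.sum_sub_distrib]
    refine Finset.sum_congr rfl fun j _ => ?_
    ring
  rw [h6]
  linarith

/-! ### The compatibility constant -/

/-- The defining property of `κ̂²`, applied to `d` rescaled to be admissible. It is stated in
`[0, ∞]`, where the right side is `∞` if `κ̂² = 0`. -/
theorem ofReal_sq_le_div_kappaSq {X : Matrix (Fin n) (Fin p) ℝ} {S : Finset (Fin p)}
    {w : {j : Fin p // j ∉ S} → ℝ} {d : Fin p → ℝ} (hn : 0 < n)
    (hX : 0 < l2norm (X *ᵥ d))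
    (hD : 0 < ∑ j ∈ S, |d j| - ∑ j : {j : Fin p // j ∉ S}, |w j * d j|) :
    ENNReal.ofReal ((√n * (∑ j ∈ S, |d j| - ∑ j : {j : Fin p // j ∉ S}, |w j * d j|)
        / l2norm (X *ᵥ d)) ^ 2)
      ≤ (S.card : ℝ≥0∞) / kappaSq X S w := by
  set D := ∑ j ∈ S, |d j| - ∑ j : {j : Fin p // j ∉ S}, |w j * d j| with hDdef
  have hn' : (0 : ℝ) < n := by exact_mod_cast hn
  -- For `S = ∅`, the bracket in `hD` could not be positive.
  have hcard : 0 < S.card := by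
    rw [Finset.card_pos, Finset.nonempty_iff_ne_empty]
    rintro rfl
    rw [Finset.sum_empty, zero_sub] at hDdef
    have : 0 ≤ ∑ j : {j : Fin p // j ∉ (∅ : Finset (Fin p))}, |w j * d j| :=
      Finset.sum_nonneg fun _ _ => abs_nonneg _
    linarith
  have hcard' : (0 : ℝ) < S.card := by exact_mod_cast hcard
  have hadm : D⁻¹ • d ∈ {b : Fin p → ℝ |
      ∑ j ∈ S, |b j| - ∑ j : {j : Fin p // j ∉ S}, |w j * b j| = 1} := by
    have hDi : |D⁻¹| = D⁻¹ := abs_of_pos (inv_pos.2 hD)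
    simp only [Set.mem_ofPred_eq, Pi.smul_apply, smul_eq_mul, mul_left_comm _ D⁻¹, abs_mul D⁻¹,
      hDi, ← Finset.mul_sum, ← mul_sub, ← hDdef]
    exact inv_mul_cancel₀ hD.ne'
  have hkappa : kappaSq X S w
      ≤ ENNReal.ofReal (S.card * (l2norm (X *ᵥ d) / D) ^ 2 / n) := by
    have hnorm : l2norm (X *ᵥ (D⁻¹ • d)) ^ 2 = (l2norm (X *ᵥ d) / D) ^ 2 := by
      rw [mulVec_smul, l2norm, WithLp.toLp_smul, norm_smul, ← l2norm, Real.norm_eq_abs,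
        abs_of_pos (inv_pos.2 hD), div_eq_inv_mul]
    rw [← hnorm]
    exact iInf₂_le (D⁻¹ • d) hadm
  refine le_trans (le_of_eq ?_) (ENNReal.div_le_div_left hkappa _)
  rw [← ENNReal.ofReal_natCast, ← ENNReal.ofReal_div_of_pos (by positivity)]
  congr 1
  rw [div_pow, mul_pow, Real.sq_sqrt hn'.le]
  field_simp

/-- From the quadratic inequality for `N = ‖X d‖` to the bound on `N`. If `N > R`, the bracket is
positive, which rules out `δ = 0`, where the weights `w` have the junk value `0`. -/
theorem ofReal_l2norm_le {X : Matrix (Fin n) (Fin p) ℝ} {S : Finset (Fin p)}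
    {w : {j : Fin p // j ∉ S} → ℝ} {d : Fin p → ℝ} {δ R : ℝ} (hδ : 0 ≤ δ) (hR : 0 ≤ R)
    {a : {j : Fin p // j ∉ S} → ℝ} (ha : ∀ j, 0 < a j) (hw : ∀ j, w j = a j / δ)
    (h : l2norm (X *ᵥ d) ^ 2 ≤ R * l2norm (X *ᵥ d)
      + (δ * ∑ j ∈ S, |d j| - ∑ j : {j : Fin p // j ∉ S}, a j * |d j|)) :
    ENNReal.ofReal (l2norm (X *ᵥ d)) ≤
      ((S.card : ℝ≥0∞) / kappaSq X S w) ^ (1 / 2 : ℝ) * ENNReal.ofReal (√(δ ^ 2 / n))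
        + ENNReal.ofReal R := by
  rcases le_or_gt (l2norm (X *ᵥ d)) R with hle | hgt
  · exact (ENNReal.ofReal_le_ofReal hle).trans le_add_self
  have hN : 0 < l2norm (X *ᵥ d) := hR.trans_lt hgt
  have hn : 0 < n := by
    rcases Nat.eq_zero_or_pos n with rfl | hn
    · rw [l2norm, Subsingleton.elim (WithLp.toLp 2 (X *ᵥ d)) 0, norm_zero] at hN
      exact absurd hN (lt_irrefl _)
    · exact hn
  have hn' : (0 : ℝ) < n := by exact_mod_cast hn
  set N := l2norm (X *ᵥ d) with hNdef
  have hG : 0 < δ * ∑ j ∈ S, |d j| - ∑ j : {j : Fin p // j ∉ S}, a j * |d j| := by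
    nlinarith [mul_pos hN (sub_pos.2 hgt)]
  have hsum : 0 ≤ ∑ j : {j : Fin p // j ∉ S}, a j * |d j| :=
    Finset.sum_nonneg fun j _ => mul_nonneg (ha j).le (abs_nonneg _)
  have hδ' : 0 < δ := by
    refine lt_of_le_of_ne hδ fun h0 => ?_
    rw [← h0, zero_mul] at hG
    linarith
  set D := ∑ j ∈ S, |d j| - ∑ j : {j : Fin p // j ∉ S}, |w j * d j| with hD
  -- As `w j = a j / δ`, the bracket is `δ` times the functional that normalizes `κ̂²`.
  have hGD : δ * ∑ j ∈ S, |d j| - ∑ j : {j : Fin p // j ∉ S}, a j * |d j| = δ * D := by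
    rw [hD, mul_sub, Finset.mul_sum (f := fun j : {j : Fin p // j ∉ S} => |w j * d j|)]
    congr 1
    refine Finset.sum_congr rfl fun j _ => ?_
    rw [abs_mul, hw, abs_of_pos (div_pos (ha j) hδ')]
    field_simp
  rw [hGD] at h hG
  have hDpos : 0 < D := pos_of_mul_pos_right hG hδ
  have hk := ENNReal.rpow_le_rpow (ofReal_sq_le_div_kappaSq hn hN hDpos)
    (by norm_num : (0 : ℝ) ≤ 1 / 2)
  rw [ENNReal.ofReal_rpow_of_nonneg (by positivity) (by norm_num), ← Real.sqrt_eq_rpow,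
    Real.sqrt_sq (by positivity), ← hD, ← hNdef] at hk
  refine le_trans ?_ (add_le_add_left (mul_le_mul_left hk _) _)
  rw [← ENNReal.ofReal_mul (by positivity), ← ENNReal.ofReal_add (by positivity) hR]
  refine ENNReal.ofReal_le_ofReal ?_
  have hval : √n * D / N * √(δ ^ 2 / n) = δ * D / N := by
    rw [Real.sqrt_div (by positivity), Real.sqrt_sq hδ]
    field_simp
  rw [hval, ← sub_le_iff_le_add, le_div_iff₀ hN]
  linarith

/-! ### The event on which the noise is small -/

/-- Union bound: each of the at most `p` two-sided tails has probability at most `e⁻ᵗ / p`. -/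
theorem stdGaussian_exists_residual_gt_le (X : Matrix (Fin n) (Fin p) ℝ) (S : Finset (Fin p))
    {t : ℝ} (ht : 0 ≤ t) :
    stdGaussian (EuclideanSpace ℝ (Fin n))
      (⋃ j, {e | ‖residual X S j‖ * √(2 * (Real.log (2 * p) + t)) < |inner ℝ (residual X S j) e|})
      ≤ ENNReal.ofReal (Real.exp (-t)) := by
  rcases Nat.eq_zero_or_pos p with rfl | hp
  · simp
  have hp' : (1 : ℝ) ≤ p := by exact_mod_cast hp
  have hτ : √(2 * (Real.log (2 * p) + t)) ^ 2 / 2 = Real.log (2 * p) + t := by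
    have := Real.log_nonneg (by linarith : (1 : ℝ) ≤ 2 * p)
    rw [Real.sq_sqrt (by positivity)]
    ring
  refine (measure_iUnion_fintype_le _ _).trans ?_
  refine (Finset.sum_le_sum fun j _ =>
    stdGaussian_abs_inner_gt_le (residual X S j) (Real.sqrt_nonneg _)).trans (le_of_eq ?_)
  rw [hτ, neg_add, Real.exp_add, Real.exp_neg, Real.exp_log (by positivity), Finset.sum_const,
    Finset.card_univ, Fintype.card_fin, nsmul_eq_mul, ← ENNReal.ofReal_natCast,
    ← ENNReal.ofReal_ofNat 2, ← ENNReal.ofReal_mul (by norm_num), ← ENNReal.ofReal_mul (by simp)]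
  congr 1
  field_simp

end Lasso

theorem mainTheorem7
    {Ω : Type*} [MeasurableSpace Ω] (P : Measure Ω) [IsProbabilityMeasure P]
    {n p : ℕ} (X : Matrix (Fin n) (Fin p) ℝ) (beta0 : Fin p → ℝ)
    -- the noise: i.i.d. standard Gaussian
    (ε : Ω → Fin n → ℝ)
    (hε_law : ∀ i, HasLaw (fun ω => ε ω i) (gaussianReal 0 1) P)
    (hε_indep : iIndepFun (fun i ω => ε ω i) P)
    -- the tuning parameters
    (lam lamStar : ℝ) (hlamStar : 0 ≤ lamStar) (hle : lamStar ≤ lam)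
    -- the Lasso based on `Y = X β⁰ + ε`
    (betaHat : Ω → Fin p → ℝ)
    (hHat : ∀ᵐ ω ∂P, Lasso.IsLasso X (X *ᵥ beta0 + ε ω) lam (betaHat ω))
    -- the noiseless Lasso and its KKT conditions
    (betaStar zetaStar : Fin p → ℝ)
    (hStar : Lasso.IsNoiselessLasso X beta0 lamStar betaStar)
    (hKKT : Lasso.NoiselessKKT X beta0 lamStar betaStar zetaStar)
    (S : Finset (Fin p)) (s : ℕ) (hs : S.card = s)
    (hS : Lasso.activeSet betaStar ⊆ S)
    (t : ℝ) (ht : 0 < t)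
    -- the norm on the left is the sup norm
    (hlam : ‖Lasso.v X S‖ * √(2 * (Real.log (2 * p) + t)) < lam)
    (hzeta : ∀ j : {j : Fin p // j ∉ S},
      lamStar * |zetaStar j| / lam < 1 - Lasso.vbar X S lam t j) :
    ∀ x : ℝ, 0 ≤ x →
      ENNReal.ofReal (1 - Real.exp (-t) - Real.exp (-x)) ≤
        P {ω | ENNReal.ofReal (Lasso.l2norm (X *ᵥ (betaHat ω - betaStar))) ≤
          ((s : ℝ≥0∞) / Lasso.kappaSq X S (Lasso.wbar X S lam lamStar t zetaStar)) ^ (1 / 2 : ℝ)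
              * ENNReal.ofReal (√((lam - lamStar) ^ 2 / n))
            + ENNReal.ofReal (√s + √(2 * x))} := by
  intro x hx
  subst hs
  set E := {ω | ENNReal.ofReal (Lasso.l2norm (X *ᵥ (betaHat ω - betaStar))) ≤
          ((S.card : ℝ≥0∞) / Lasso.kappaSq X S (Lasso.wbar X S lam lamStar t zetaStar))
              ^ (1 / 2 : ℝ) * ENNReal.ofReal (√((lam - lamStar) ^ 2 / n))
            + ENNReal.ofReal (√S.card + √(2 * x))} with hE
  set τ := √(2 * (Real.log (2 * p) + t)) with hτ
  have hlam0 : 0 < lam := lt_of_le_of_lt (by positivity) hlam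
  set noise : Ω → EuclideanSpace ℝ (Fin n) := fun ω => WithLp.toLp 2 (ε ω)
  have hnoise : HasLaw noise (stdGaussian (EuclideanSpace ℝ (Fin n))) P :=
    hasLaw_toLp_stdGaussian hε_law hε_indep
  -- Only this inequality is needed, and it holds for all sets, measurable or not.
  have hpull : ∀ A : Set (EuclideanSpace ℝ (Fin n)), P (noise ⁻¹' A) ≤ stdGaussian _ A :=
    fun A => (Measure.le_map_apply hnoise.aemeasurable A).trans_eq (by rw [hnoise.map_eq])
  set A : Set (EuclideanSpace ℝ (Fin n)) :=
    {e | √S.card + √(2 * x) < ‖(Lasso.colSpan X S).starProjection e‖}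
  set B : Set (EuclideanSpace ℝ (Fin n)) :=
    ⋃ j, {e | ‖Lasso.residual X S j‖ * τ < |inner ℝ (Lasso.residual X S j) e|}
  have hA : P (noise ⁻¹' A) ≤ ENNReal.ofReal (Real.exp (-x)) :=
    (hpull A).trans (stdGaussian_norm_starProjection_gt_le _ (Lasso.finrank_colSpan_le X S) hx)
  have hB : P (noise ⁻¹' B) ≤ ENNReal.ofReal (Real.exp (-t)) :=
    (hpull B).trans (Lasso.stdGaussian_exists_residual_gt_le X S ht.le)
  have hgood : ∀ ω, Lasso.IsLasso X (X *ᵥ beta0 + ε ω) lam (betaHat ω) →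
      noise ω ∉ A → noise ω ∉ B → ω ∈ E := by
    intro ω hω hωA hωB
    simp only [A, B, Set.mem_ofPred_eq, Set.mem_iUnion, not_exists, not_lt] at hωA hωB
    have hbasic := Lasso.l2norm_sq_sub_le_of_isLasso hlamStar hle hω hKKT hS
      (fun j => hωB j)
    rw [hE, Set.mem_ofPred_eq]
    refine Lasso.ofReal_l2norm_le (sub_nonneg.2 hle) (by positivity)
      (a := fun j => lam - Lasso.v X S j * τ - lamStar * |zetaStar j|) (fun j => ?_) (fun j => ?_)
      (hbasic.trans ?_)
    · have := hzeta j
      rw [Lasso.vbar, one_sub_div hlam0.ne', div_lt_div_iff_of_pos_right hlam0] at this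
      linarith
    · rw [Lasso.wbar, Lasso.vbar, ← hτ, one_sub_div hlam0.ne', ← sub_div, one_sub_div hlam0.ne',
        div_div_div_cancel_right₀ hlam0.ne']
    · gcongr
      exact norm_nonneg _
  have hcompl : P Eᶜ ≤ ENNReal.ofReal (Real.exp (-t)) + ENNReal.ofReal (Real.exp (-x)) := by
    calc P Eᶜ ≤ P (noise ⁻¹' B ∪ noise ⁻¹' A) := by
          refine measure_mono_ae ?_
          filter_upwards [hHat] with ω hω hωE
          by_contra hcon
          exact hωE (hgood ω hω (fun h => hcon (Or.inr h)) (fun h => hcon (Or.inl h)))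
      _ ≤ P (noise ⁻¹' B) + P (noise ⁻¹' A) := measure_union_le _ _
      _ ≤ _ := add_le_add hB hA
  rw [ENNReal.ofReal_sub _ (Real.exp_pos _).le, ENNReal.ofReal_sub _ (Real.exp_pos _).le,
    ENNReal.ofReal_one, tsub_tsub]
  refine tsub_le_iff_right.2 ?_
  calc (1 : ℝ≥0∞) = P (E ∪ Eᶜ) := by rw [Set.union_compl_self, measure_univ]
    _ ≤ P E + P Eᶜ := measure_union_le _ _
    _ ≤ _ := by gcongr
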